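/- For real numbers $c,d>0$ let $F(c,d;c+d;x)=\sum_{n=0}^{\infty}\frac{(c)_n(d)_n}{(c+d)_n}\frac{x^n}{n!}$, $|x|<1$, be the zero-balanced Gaussian hypergeometric function, where $(a)_0=1$ and $(a)_n=a(a+1)\cdots(a+n-1)$ for $n\ge 1$, and let $B(c,d)=\frac{\Gamma(c)\Gamma(d)}{\Gamma(c+d)}$ be the beta function. For $x,y\in(0,1)$ set $$g(x)=x\,F(c,d;c+d;x),\qquad Q_g(x,y)=\frac{g(x)+g(y)}{g(x+y-xy)}.$$ (1) If $c,d>0$ and $cd\le 1$, then for all $x,y\in(0,1)$ $$\frac{1}{B(c,d)}\le Q_g(x,y)\le B(c,d).$$ (2) If $c,d>0$ and $\frac1c+\frac1d\le 2$, then for all $x,y\in(0,1)$ $$B(c,d)\le Q_g(x,y)\le \frac{1}{B(c,d)}.$$ -/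

import Mathlib

/-- The function `g(x) = x F(c,d;c+d;x)`, with `F = ₂F₁` the Gaussian hypergeometric function. -/
noncomputable def zeroBalancedG (c d x : ℝ) : ℝ :=
  x * ₂F₁ c d (c + d) x

/-- The quotient `Q_g(x,y) = (g(x) + g(y)) / g(x + y - xy)`. -/
noncomputable def quotientQ (g : ℝ → ℝ) (x y : ℝ) : ℝ :=
  (g x + g y) / g (x + y - x * y)

/-! Write `L x = -log (1 - x) = ∑ x^(n+1)/(n+1)`; then `L (x + y - x*y) = L x + L y`, so the
quotient for `L` is identically 1. If the coefficient ratios of `g` to `L` lie in `[m, M]`, then `m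
L ≤ g ≤ M L`, and the quotient for `g` lies in `[m/M, M/m]`. The ratios start at 1, tend to
`1/B(c,d)`, and are monotone in either regime, so 1 and `1/B` are the bounds. -/

open Filter Topology

/-- The ratio of the `n`-th power series coefficients of `₂F₁ c d (c + d)` and of
`-log (1 - x) / x`. -/
noncomputable def zeroBalancedRatio (c d : ℝ) (n : ℕ) : ℝ :=
  (n + 1) * (((n.factorial : ℝ))⁻¹ * (ascPochhammer ℝ n).eval c * (ascPochhammer ℝ n).eval d *
    ((ascPochhammer ℝ n).eval (c + d))⁻¹)

theorem zeroBalancedRatio_zero (c d : ℝ) : zeroBalancedRatio c d 0 = 1 := by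
  simp [zeroBalancedRatio]

theorem zeroBalancedRatio_pos {c d : ℝ} (hc : 0 < c) (hd : 0 < d) (n : ℕ) :
    0 < zeroBalancedRatio c d n := by
  have h1 := ascPochhammer_pos n c hc
  have h2 := ascPochhammer_pos n d hd
  have h3 := ascPochhammer_pos n (c + d) (add_pos hc hd)
  unfold zeroBalancedRatio
  positivity

theorem zeroBalancedRatio_succ {c d : ℝ} (hc : 0 < c) (hd : 0 < d) (n : ℕ) :
    zeroBalancedRatio c d (n + 1) = zeroBalancedRatio c d n *
      (((c + n) * (d + n) * (n + 2)) / ((c + d + n) * (n + 1) ^ 2)) := by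
  have h3 := ascPochhammer_pos n (c + d) (add_pos hc hd)
  have h4 : 0 < c + d + n := by positivity
  simp only [zeroBalancedRatio, ascPochhammer_succ_eval, Nat.factorial_succ]
  push_cast
  field_simp
  ring

theorem antitone_zeroBalancedRatio {c d : ℝ} (hc : 0 < c) (hd : 0 < d) (h : c * d ≤ 1) :
    Antitone (zeroBalancedRatio c d) := by
  refine antitone_nat_of_succ_le fun n ↦ ?_
  rw [zeroBalancedRatio_succ hc hd]
  refine mul_le_of_le_one_right (zeroBalancedRatio_pos hc hd n).le ?_
  have hn : (0 : ℝ) ≤ n := n.cast_nonneg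
  have h2 : 2 * (c * d) ≤ c + d := by
    have : 0 < c * d := mul_pos hc hd
    refine abs_le_of_sq_le_sq' ?_ (by positivity) |>.2
    nlinarith [sq_nonneg (c - d)]
  rw [div_le_one (by positivity)]
  -- Numerator minus denominator is `(c*d - 1)*n + (2*c*d - (c + d))`.
  nlinarith [mul_nonneg hn (sub_nonneg.2 h)]

theorem monotone_zeroBalancedRatio {c d : ℝ} (hc : 0 < c) (hd : 0 < d) (h : 1 / c + 1 / d ≤ 2) :
    Monotone (zeroBalancedRatio c d) := by
  refine monotone_nat_of_le_succ fun n ↦ ?_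
  rw [zeroBalancedRatio_succ hc hd]
  refine le_mul_of_one_le_right (zeroBalancedRatio_pos hc hd n).le ?_
  have hn : (0 : ℝ) ≤ n := n.cast_nonneg
  have hcd : 0 < c * d := mul_pos hc hd
  have h2 : c + d ≤ 2 * (c * d) := by
    rw [div_add_div _ _ hc.ne' hd.ne', div_le_iff₀ hcd] at h
    linarith
  have h1 : 1 ≤ c * d := by
    -- AM-GM: `4cd ≤ (c + d)^2 ≤ 4(cd)^2`.
    have : c * d * 1 ≤ c * d * (c * d) := by nlinarith [sq_nonneg (c - d)]
    exact le_of_mul_le_mul_left this hcd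
  rw [one_le_div (by positivity)]
  nlinarith [mul_nonneg hn (sub_nonneg.2 h1)]

theorem ascPochhammer_eval_eq_prod_range (n : ℕ) (s : ℝ) :
    (ascPochhammer ℝ n).eval s = ∏ j ∈ Finset.range n, (s + j) := by
  induction n with
  | zero => simp
  | succ n ih => rw [ascPochhammer_succ_eval, Finset.prod_range_succ, ih]

theorem tendsto_zeroBalancedRatio {c d : ℝ} (hc : 0 < c) (hd : 0 < d) :
    Tendsto (zeroBalancedRatio c d) atTop (𝓝 (1 / ProbabilityTheory.beta c d)) := by
  -- `GammaSeq s n` has `n + 1` factors in its denominator, hence the shift; what remains is the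
  -- factor `(n+2)/(n+1)`.
  rw [← tendsto_add_atTop_iff_nat 1]
  have hΓ := (Real.GammaSeq_tendsto_Gamma (c + d)).div
    ((Real.GammaSeq_tendsto_Gamma c).mul (Real.GammaSeq_tendsto_Gamma d))
    (mul_pos (Real.Gamma_pos_of_pos hc) (Real.Gamma_pos_of_pos hd)).ne'
  have hq : Tendsto (fun n : ℕ ↦ 1 + 1 / ((n : ℝ) + 1)) atTop (𝓝 (1 + 0)) :=
    tendsto_const_nhds.add tendsto_one_div_add_atTop_nhds_zero_nat
  have key := hq.mul hΓ
  rw [add_zero, one_mul] at key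
  rw [ProbabilityTheory.beta, one_div_div]
  refine key.congr' ?_
  filter_upwards [eventually_gt_atTop 0] with n hn
  have hn' : (0 : ℝ) < n := Nat.cast_pos.2 hn
  have h1 := ascPochhammer_pos (n + 1) c hc
  have h2 := ascPochhammer_pos (n + 1) d hd
  have h3 := ascPochhammer_pos (n + 1) (c + d) (add_pos hc hd)
  have h4 := Real.rpow_pos_of_pos hn' c
  have h5 := Real.rpow_pos_of_pos hn' d
  simp only [Pi.div_apply, Real.GammaSeq, zeroBalancedRatio, ← ascPochhammer_eval_eq_prod_range,
    Real.rpow_add hn', Nat.factorial_succ]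
  push_cast
  field_simp

theorem zeroBalancedG_mem_Icc {c d m M x : ℝ} (hm : 0 < m)
    (h : ∀ n, zeroBalancedRatio c d n ∈ Set.Icc m M) (hx : x ∈ Set.Ioo (0 : ℝ) 1) :
    zeroBalancedG c d x ∈ Set.Icc (m * -Real.log (1 - x)) (M * -Real.log (1 - x)) := by
  have hL := Real.hasSum_pow_div_log_of_abs_lt_one (abs_lt.2 ⟨by linarith [hx.1], hx.2⟩)
  have hp : ∀ n : ℕ, 0 ≤ x ^ (n + 1) / ((n : ℝ) + 1) := fun n ↦ by
    have := hx.1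
    positivity
  have hg : zeroBalancedG c d x =
      ∑' n : ℕ, zeroBalancedRatio c d n * (x ^ (n + 1) / ((n : ℝ) + 1)) := by
    rw [zeroBalancedG, ordinaryHypergeometric_eq_tsum, ← tsum_mul_left]
    refine tsum_congr fun n ↦ ?_
    have : (n : ℝ) + 1 ≠ 0 := by positivity
    simp only [zeroBalancedRatio, smul_eq_mul]
    field_simp
    ring
  have hle : ∀ n : ℕ, zeroBalancedRatio c d n * (x ^ (n + 1) / ((n : ℝ) + 1)) ≤
      M * (x ^ (n + 1) / ((n : ℝ) + 1)) := fun n ↦ mul_le_mul_of_nonneg_right (h n).2 (hp n)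
  -- Convergence of the hypergeometric series comes from comparison with the logarithm.
  have hsum := Summable.of_nonneg_of_le
    (fun n ↦ mul_nonneg (hm.le.trans (h n).1) (hp n)) hle (hL.mul_left M).summable
  rw [hg]
  exact ⟨hasSum_le (fun n ↦ mul_le_mul_of_nonneg_right (h n).1 (hp n)) (hL.mul_left m)
    hsum.hasSum, hasSum_le hle hsum.hasSum (hL.mul_left M)⟩

theorem quotientQ_zeroBalancedG_mem_Icc {c d m M x y : ℝ} (hm : 0 < m)
    (h : ∀ n, zeroBalancedRatio c d n ∈ Set.Icc m M)
    (hx : x ∈ Set.Ioo (0 : ℝ) 1) (hy : y ∈ Set.Ioo (0 : ℝ) 1) :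
    quotientQ (zeroBalancedG c d) x y ∈ Set.Icc (m / M) (M / m) := by
  obtain ⟨hx0, hx1⟩ := hx
  obtain ⟨hy0, hy1⟩ := hy
  have hz : x + y - x * y ∈ Set.Ioo (0 : ℝ) 1 := ⟨by nlinarith, by nlinarith⟩
  obtain ⟨a1, a2⟩ := zeroBalancedG_mem_Icc hm h ⟨hx0, hx1⟩
  obtain ⟨b1, b2⟩ := zeroBalancedG_mem_Icc hm h ⟨hy0, hy1⟩
  obtain ⟨e1, e2⟩ := zeroBalancedG_mem_Icc hm h hz
  have hL0 : 0 < -Real.log (1 - (x + y - x * y)) :=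
    neg_pos.2 (Real.log_neg (by linarith [hz.2]) (by linarith [hz.1]))
  have hL : -Real.log (1 - (x + y - x * y)) = -Real.log (1 - x) + -Real.log (1 - y) := by
    rw [show 1 - (x + y - x * y) = (1 - x) * (1 - y) by ring,
      Real.log_mul (by linarith) (by linarith)]
    ring
  have hM : 0 < M := hm.trans_le ((h 0).1.trans (h 0).2)
  have hg : 0 < zeroBalancedG c d (x + y - x * y) := (mul_pos hm hL0).trans_le e1
  have hlo : m * -Real.log (1 - (x + y - x * y)) ≤ zeroBalancedG c d x + zeroBalancedG c d y := by
    rw [hL]; linarith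
  have hhi : zeroBalancedG c d x + zeroBalancedG c d y ≤ M * -Real.log (1 - (x + y - x * y)) := by
    rw [hL]; linarith
  constructor
  · rw [quotientQ, div_le_div_iff₀ hM hg]
    nlinarith [mul_le_mul_of_nonneg_left e2 hm.le, mul_le_mul_of_nonneg_left hlo hM.le]
  · rw [quotientQ, div_le_div_iff₀ hg hm]
    nlinarith [mul_le_mul_of_nonneg_left e1 hM.le, mul_le_mul_of_nonneg_left hhi hm.le]

theorem mainTheorem4 :
    (∀ c d : ℝ, 0 < c → 0 < d → c * d ≤ 1 →
      ∀ x ∈ Set.Ioo (0 : ℝ) 1, ∀ y ∈ Set.Ioo (0 : ℝ) 1,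
        1 / ProbabilityTheory.beta c d ≤ quotientQ (zeroBalancedG c d) x y ∧
          quotientQ (zeroBalancedG c d) x y ≤ ProbabilityTheory.beta c d) ∧
    (∀ c d : ℝ, 0 < c → 0 < d → 1 / c + 1 / d ≤ 2 →
      ∀ x ∈ Set.Ioo (0 : ℝ) 1, ∀ y ∈ Set.Ioo (0 : ℝ) 1,
        ProbabilityTheory.beta c d ≤ quotientQ (zeroBalancedG c d) x y ∧
          quotientQ (zeroBalancedG c d) x y ≤ 1 / ProbabilityTheory.beta c d) := by
  refine ⟨fun c d hc hd h x hx y hy ↦ ?_, fun c d hc hd h x hx y hy ↦ ?_⟩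
  · have hmono := antitone_zeroBalancedRatio hc hd h
    have hr : ∀ n, zeroBalancedRatio c d n ∈ Set.Icc (1 / ProbabilityTheory.beta c d) 1 :=
      fun n ↦ ⟨hmono.le_of_tendsto (tendsto_zeroBalancedRatio hc hd) n,
        (hmono n.zero_le).trans_eq (zeroBalancedRatio_zero c d)⟩
    have := quotientQ_zeroBalancedG_mem_Icc
      (one_div_pos.2 (ProbabilityTheory.beta_pos hc hd)) hr hx hy
    rwa [div_one, one_div_one_div] at this
  · have hmono := monotone_zeroBalancedRatio hc hd h
    have hr : ∀ n, zeroBalancedRatio c d n ∈ Set.Icc 1 (1 / ProbabilityTheory.beta c d) :=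
      fun n ↦ ⟨(zeroBalancedRatio_zero c d).ge.trans (hmono n.zero_le),
        hmono.ge_of_tendsto (tendsto_zeroBalancedRatio hc hd) n⟩
    have := quotientQ_zeroBalancedG_mem_Icc one_pos hr hx hy
    rwa [div_one, one_div_one_div] at this
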